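/- **Theorem 1.2.** Let $S_i(x)=r_iR_i(x)+b_i$ ($1\le i\le m$) be similitudes of $\mathbb R^d$ with $0<r_i<1$, $R_i$ orthogonal and $b_i\in\mathbb R^d$. Let $K$ be the self-similar set they generate, i.e. the non-empty compact set with $K=\bigcup_{i=1}^m S_i(K)$, and assume the strong separation condition $S_i(K)\cap S_j(K)=\emptyset$ for $i\ne j$. Let $s$ be the Hausdorff dimension of $K$. Let $p_1,\dots,p_m\ge 0$ with $\sum_{i=1}^m p_i=1$, and let $\mu$ be the associated self-similar measure, i.e. the Borel probability measure on $\mathbb R^d$ with $\mu=\sum_{i=1}^m p_i\,\mu\circ S_i^{-1}$. Let $\mathcal D$ be the family of basic cubes $K_{\mathbf i}=S_{i_1}\circ\cdots\circ S_{i_n}(K)$, where $\mathbf i=i_1\cdots i_n$ runs over all finite words in $\{1,\dots,m\}$, including the empty word (which gives $K$). For a $\mu$-measurable $f:K\to\mathbb R$ and $x\in K$ put $$M_{\mathcal D}^\mu f(x)=\sup\Big\{\frac1{\mu(I)}\int_I|f|\,d\mu:\ I\in\mathcal D,\ x\in I\Big\}\in[0,\infty]\qquad(\text{with }0/0=0).$$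 For $0<\alpha\le s$, $E\subset K$ and $g:K\to[0,\infty)$ put $$H^\alpha_\mu(E)=\inf\Big\{\sum_j\mu(I_j)^{\alpha/s}:\ E\subset\bigcup_j I_j,\ I_j\in\mathcal D\Big\},\qquad \int_K g\,dH^\alpha_\mu=\int_0^\infty H^\alpha_\mu(\{x\in K:\ g(x)>t\})\,dt,$$ where the infimum is over all finite or countable families of basic cubes. Let $0<\alpha\le s$, and let $f:K\to\mathbb R$ be $\mu$-measurable with $\int_K|f|^{\alpha/s}\,dH^\alpha_\mu<\infty$. Then, for every $t>0$, $$H^\alpha_\mu(\{x\in K:\ M_{\mathcal D}^\mu f(x)>t\})\le 4\Big(\frac s\alpha\Big)^{\alpha/s}t^{-\alpha/s}\int_K|f|^{\alpha/s}\,dH^\alpha_\mu .$$ -/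

import Mathlib

open MeasureTheory Set
open scoped ENNReal

/-- An iterated function system of `m` contractive similitudes of `ℝ^d`,
`S_i(x) = r_i R_i(x) + b_i` with `0 < r_i < 1`, `R_i` orthogonal and `b_i ∈ ℝ^d`. -/
structure SimilitudeIFS (d m : ℕ) where
  /-- the contraction ratios `r_i` -/
  ratio : Fin m → ℝ
  ratio_pos : ∀ i, 0 < ratio i
  ratio_lt_one : ∀ i, ratio i < 1
  /-- the orthogonal transformations `R_i` -/
  rot : Fin m → (EuclideanSpace ℝ (Fin d) ≃ₗᵢ[ℝ] EuclideanSpace ℝ (Fin d))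
  /-- the translation vectors `b_i` -/
  trans : Fin m → EuclideanSpace ℝ (Fin d)

namespace SimilitudeIFS

variable {d m : ℕ}

/-- The similitude `S_i(x) = r_i R_i(x) + b_i`. -/
noncomputable def map (S : SimilitudeIFS d m) (i : Fin m) (x : EuclideanSpace ℝ (Fin d)) :
    EuclideanSpace ℝ (Fin d) :=
  S.ratio i • S.rot i x + S.trans i

/-- `K` is the self-similar set generated by the system: a non-empty compact set with
`K = ⋃ i, S_i(K)` (there is exactly one such set if `m ≥ 1`). -/
def IsSelfSimilarSet (S : SimilitudeIFS d m) (K : Set (EuclideanSpace ℝ (Fin d))) : Prop :=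
  K.Nonempty ∧ IsCompact K ∧ K = ⋃ i, S.map i '' K

/-- The strong separation condition: the sets `S_i(K)` are pairwise disjoint. -/
def StrongSeparation (S : SimilitudeIFS d m) (K : Set (EuclideanSpace ℝ (Fin d))) : Prop :=
  ∀ i j, i ≠ j → Disjoint (S.map i '' K) (S.map j '' K)

/-- `μ` is the self-similar measure with weights `p`: a Borel probability measure on `ℝ^d` with
`μ = ∑ i, p_i • (μ ∘ S_i⁻¹)` (there is exactly one if `p` is a probability vector). -/
def IsSelfSimilarMeasure (S : SimilitudeIFS d m) (p : Fin m → ℝ)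
    (μ : Measure (EuclideanSpace ℝ (Fin d))) : Prop :=
  IsProbabilityMeasure μ ∧ μ = ∑ i, ENNReal.ofReal (p i) • μ.map (S.map i)

/-- `S_w = S_{i_1} ∘ ⋯ ∘ S_{i_n}` for a finite word `w = i_1 ⋯ i_n`; the empty word gives the
identity. -/
noncomputable def wordMap (S : SimilitudeIFS d m) :
    List (Fin m) → EuclideanSpace ℝ (Fin d) → EuclideanSpace ℝ (Fin d)
  | [] => id
  | i :: w => S.map i ∘ S.wordMap w

/-- The basic cube `K_w = S_w(K)`. -/
def cube (S : SimilitudeIFS d m) (K : Set (EuclideanSpace ℝ (Fin d))) (w : List (Fin m)) :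
    Set (EuclideanSpace ℝ (Fin d)) :=
  S.wordMap w '' K

/-- The (countable) family `𝒟` of all basic cubes, `K` itself included. -/
def basicCubes (S : SimilitudeIFS d m) (K : Set (EuclideanSpace ℝ (Fin d))) :
    Set (Set (EuclideanSpace ℝ (Fin d))) :=
  {I | ∃ w : List (Fin m), I = S.cube K w}

/-- The maximal function `M f(x) = sup_n μ(K_n(x))⁻¹ ∫_{K_n(x)} |f| dμ`, where `K_n(x)` is the
basic cube of generation `n` that contains `x` (under strong separation there is exactly one for
each `x ∈ K`, so that the supremum runs over all basic cubes containing `x`).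
It takes values in `[0, ∞]`, and `0 / 0 = 0` for cubes of measure zero. -/
noncomputable def maximalFunction (S : SimilitudeIFS d m) (K : Set (EuclideanSpace ℝ (Fin d)))
    (μ : Measure (EuclideanSpace ℝ (Fin d))) (f : EuclideanSpace ℝ (Fin d) → ℝ)
    (x : EuclideanSpace ℝ (Fin d)) : ℝ≥0∞ :=
  ⨆ (w : List (Fin m)) (_ : x ∈ S.cube K w),
    (∫⁻ y in S.cube K w, ENNReal.ofReal |f y| ∂μ) / μ (S.cube K w)

/-- The Hausdorff content
`H^α_μ(E) = inf {∑_j μ(I_j)^(α/s) : E ⊆ ⋃_j I_j, I_j ∈ 𝒟}`.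
As `𝒟` is countable, every family `C` of basic cubes is finite or countable. -/
noncomputable def hausdorffContent (S : SimilitudeIFS d m) (K : Set (EuclideanSpace ℝ (Fin d)))
    (μ : Measure (EuclideanSpace ℝ (Fin d))) (s α : ℝ) (E : Set (EuclideanSpace ℝ (Fin d))) :
    ℝ≥0∞ :=
  ⨅ (C : Set (Set (EuclideanSpace ℝ (Fin d)))) (_ : C ⊆ S.basicCubes K) (_ : E ⊆ ⋃₀ C),
    ∑' I : C, μ (I : Set (EuclideanSpace ℝ (Fin d))) ^ (α / s)

/-- The Choquet integral `∫_K g dH^α_μ = ∫_0^∞ H^α_μ({x ∈ K : g(x) > t}) dt` of a function `g`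
that is nonnegative on `K`. -/
noncomputable def choquetIntegral (S : SimilitudeIFS d m) (K : Set (EuclideanSpace ℝ (Fin d)))
    (μ : Measure (EuclideanSpace ℝ (Fin d))) (s α : ℝ) (g : EuclideanSpace ℝ (Fin d) → ℝ) :
    ℝ≥0∞ :=
  ∫⁻ t in Ioi (0 : ℝ), S.hausdorffContent K μ s α {x ∈ K | t < g x}

end SimilitudeIFS

/-- The content of `E` with respect to a family `D` of sets with weights `φ`: the infimum of the
total weights of the subfamilies of `D` that cover `E`. -/
noncomputable def netContent {X : Type*} (D : Set (Set X)) (φ : Set X → ℝ≥0∞) (E : Set X) :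
    ℝ≥0∞ :=
  ⨅ (C : Set (Set X)) (_ : C ⊆ D) (_ : E ⊆ ⋃₀ C), ∑' I : C, φ I

/-- A net: a countable family of nonempty sets, any two of which are nested or disjoint, and each
of which is contained in only finitely many others. -/
structure IsNet {X : Type*} (D : Set (Set X)) : Prop where
  countable : D.Countable
  nonempty : ∀ I ∈ D, I.Nonempty
  nested : ∀ I ∈ D, ∀ J ∈ D, I ⊆ J ∨ J ⊆ I ∨ Disjoint I J
  finite_supersets : ∀ I ∈ D, {J ∈ D | I ⊆ J}.Finite

section Net

variable {X : Type*} {D : Set (Set X)} {φ : Set X → ℝ≥0∞}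

theorem netContent_le {E : Set X} {C : Set (Set X)} (hC : C ⊆ D) (hE : E ⊆ ⋃₀ C) :
    netContent D φ E ≤ ∑' I : C, φ I :=
  iInf_le_of_le C <| iInf_le_of_le hC <| iInf_le _ hE

theorem le_netContent {E : Set X} {a : ℝ≥0∞}
    (h : ∀ C ⊆ D, E ⊆ ⋃₀ C → a ≤ ∑' I : C, φ I) : a ≤ netContent D φ E :=
  le_iInf fun C => le_iInf fun hC => le_iInf fun hE => h C hC hE

theorem netContent_mono {E F : Set X} (h : E ⊆ F) : netContent D φ E ≤ netContent D φ F :=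
  le_netContent fun _ hC hF => netContent_le hC (h.trans hF)

theorem rpow_tsum_le_tsum_rpow_of_le_one {ι : Type*} (g : ι → ℝ≥0∞) {q : ℝ} (hq : 0 < q)
    (hq1 : q ≤ 1) : (∑' i, g i) ^ q ≤ ∑' i, g i ^ q := by
  classical
  have hfin : ∀ s : Finset ι, (∑ i ∈ s, g i) ^ q ≤ ∑ i ∈ s, g i ^ q := by
    intro s
    induction s using Finset.induction_on with
    | empty => simp [hq]
    | insert a s ha ih =>
      rw [Finset.sum_insert ha, Finset.sum_insert ha]
      exact (ENNReal.rpow_add_le_add_rpow _ _ hq.le hq1).trans (by gcongr)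
  rw [← ENNReal.le_rpow_inv_iff hq, ENNReal.tsum_eq_iSup_sum]
  refine iSup_le fun s => ?_
  rw [ENNReal.le_rpow_inv_iff hq]
  exact (hfin s).trans (ENNReal.sum_le_tsum s)

theorem measure_rpow_le_netContent [MeasurableSpace X] (hD : D.Countable) (μ : Measure X) {q : ℝ}
    (hq : 0 < q) (hq1 : q ≤ 1) (E : Set X) : μ E ^ q ≤ netContent D (fun I => μ I ^ q) E := by
  refine le_netContent fun C hC hE => ?_
  have hcount : C.Countable := hD.mono hC
  calc μ E ^ q ≤ (∑' I : C, μ I) ^ q := by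
        refine ENNReal.rpow_le_rpow ((measure_mono hE).trans ?_) hq.le
        rw [sUnion_eq_biUnion]
        exact measure_biUnion_le μ hcount fun I => I
    _ ≤ _ := rpow_tsum_le_tsum_rpow_of_le_one _ hq hq1

/-- The members of `P` that are maximal for inclusion. -/
def maximalMembers (P : Set (Set X)) : Set (Set X) := {I | Maximal (· ∈ P) I}

theorem maximalMembers_subset (P : Set (Set X)) : maximalMembers P ⊆ P := fun _ h => h.prop

theorem IsNet.disjoint_maximalMembers (hD : IsNet D) {P : Set (Set X)} (hP : P ⊆ D) :
    (maximalMembers P).PairwiseDisjoint id := by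
  intro I hI J hJ hne
  rcases hD.nested I (hP hI.prop) J (hP hJ.prop) with h | h | h
  · exact absurd (hI.eq_of_subset hJ.prop h) hne
  · exact absurd (hJ.eq_of_subset hI.prop h).symm hne
  · exact h

theorem IsNet.exists_maximalMembers (hD : IsNet D) {P : Set (Set X)} (hP : P ⊆ D) {I : Set X}
    (hI : I ∈ P) : ∃ J ∈ maximalMembers P, I ⊆ J := by
  have hfin : {J ∈ P | I ⊆ J}.Finite :=
    (hD.finite_supersets I (hP hI)).subset fun J hJ => ⟨hP hJ.1, hJ.2⟩
  obtain ⟨J, hJ⟩ := hfin.exists_maximal ⟨I, hI, Subset.rfl⟩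
  exact ⟨J, ⟨hJ.prop.1, fun L hL hJL => hJ.2 ⟨hL, hJ.prop.2.trans hJL⟩ hJL⟩, hJ.prop.2⟩

/-- A subfamily `F` is packed if within each member `I` of the net its total weight is at most
twice the weight of `I`. -/
def IsPacked (D : Set (Set X)) (φ : Set X → ℝ≥0∞) (F : Set (Set X)) : Prop :=
  ∀ I ∈ D, ∑' J : {J ∈ F | J ⊆ I}, φ J ≤ 2 * φ I

theorem IsPacked.mono {F G : Set (Set X)} (hG : IsPacked D φ G) (h : F ⊆ G) :
    IsPacked D φ F := by
  refine fun I hI => le_trans ?_ (hG I hI)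
  exact ENNReal.tsum_mono_subtype φ fun _ hJ => ⟨h hJ.1, hJ.2⟩

theorem isPacked_of_finite_subsets {F : Set (Set X)}
    (h : ∀ G ⊆ F, G.Finite → IsPacked D φ G) : IsPacked D φ F := by
  intro I hI
  rw [ENNReal.tsum_eq_iSup_sum]
  refine iSup_le fun s => ?_
  let e : {J ∈ F | J ⊆ I} ↪ Set X := ⟨Subtype.val, Subtype.val_injective⟩
  let G : Finset (Set X) := s.map e
  have hG : ∀ J ∈ G, J ∈ F ∧ J ⊆ I := by
    intro J hJ
    obtain ⟨J', -, rfl⟩ := Finset.mem_map.1 hJ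
    exact J'.2
  calc ∑ J ∈ s, φ J = ∑ J ∈ G, φ J := (Finset.sum_map s e φ).symm
    _ = ∑' J : (G : Set (Set X)), φ J := (Finset.tsum_subtype' G φ).symm
    _ ≤ ∑' J : {J ∈ (G : Set (Set X)) | J ⊆ I}, φ J :=
        ENNReal.tsum_mono_subtype φ fun J hJ => ⟨hJ, (hG J hJ).2⟩
    _ ≤ 2 * φ I := h G (fun J hJ => (hG J hJ).1) G.finite_toSet I hI

/-- Superadditivity up to a factor `2` of the content along a disjoint packed family. -/
theorem IsNet.tsum_netContent_inter_le (hD : IsNet D) {F : Set (Set X)} (hF : F ⊆ D)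
    (hdisj : F.PairwiseDisjoint id) (hpack : IsPacked D φ F) (A : Set X) :
    ∑' J : F, netContent D φ (A ∩ J) ≤ 2 * netContent D φ A := by
  classical
  rw [mul_comm, ← ENNReal.div_le_iff (by simp) (by simp)]
  refine le_netContent fun C hC hA => ?_
  rw [ENNReal.div_le_iff (by simp) (by simp), mul_comm]
  let a : Set X → Set X → ℝ≥0∞ := fun J I => if J ⊆ I then φ J else if I ⊆ J then φ I else 0
  have hle : ∀ J ∈ F, netContent D φ (A ∩ J) ≤ ∑' I : C, a J I := by
    intro J hJ
    by_cases h : ∃ I ∈ C, J ⊆ I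
    · obtain ⟨I, hI, hJI⟩ := h
      calc netContent D φ (A ∩ J) ≤ ∑' L : ({J} : Set (Set X)), φ L :=
            netContent_le (by simpa using hF hJ) (by simp)
        _ = a J I := by simp [a, hJI]
        _ ≤ ∑' I : C, a J I := ENNReal.le_tsum (f := fun I : C => a J I) ⟨I, hI⟩
    · push Not at h
      calc netContent D φ (A ∩ J) ≤ ∑' I : {I ∈ C | I ⊆ J}, φ I := by
            refine netContent_le (fun I hI => hC hI.1) ?_
            rintro x ⟨hxA, hxJ⟩
            obtain ⟨I, hI, hxI⟩ := hA hxA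
            refine ⟨I, ⟨hI, ?_⟩, hxI⟩
            rcases hD.nested I (hC hI) J (hF hJ) with h' | h' | h'
            · exact h'
            · exact absurd h' (h I hI)
            · exact absurd hxJ (disjoint_left.1 h' hxI)
        _ ≤ ∑' I : C, a J I := by
            rw [tsum_subtype, tsum_subtype C (a J)]
            refine ENNReal.tsum_le_tsum fun I => indicator_le (fun I hI => ?_) I
            rw [indicator_of_mem hI.1]
            simp [a, h I hI.1, hI.2]
  have hge : ∀ I ∈ C, ∑' J : F, a J I ≤ 2 * φ I := by
    intro I hI
    by_cases h : ∃ J ∈ F, I ⊆ J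
    · obtain ⟨J, hJ, hIJ⟩ := h
      have hzero : ∀ L : F, L ≠ ⟨J, hJ⟩ → a L I = 0 := by
        rintro ⟨L, hL⟩ hne
        have hLJ : Disjoint L J := hdisj hL hJ fun h => hne (Subtype.ext h)
        have h1 : ¬ L ⊆ I := fun h => (hD.nonempty L (hF hL)).ne_empty
          (disjoint_self.1 (hLJ.mono_right (h.trans hIJ)))
        have h2 : ¬ I ⊆ L := fun h => (hD.nonempty I (hC hI)).ne_empty
          (disjoint_self.1 (hLJ.mono h hIJ))
        simp [a, h1, h2]
      rw [tsum_eq_single (⟨J, hJ⟩ : F) hzero]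
      refine le_trans ?_ (le_mul_of_one_le_left (zero_le) one_le_two)
      by_cases h' : J ⊆ I
      · simp [a, h'.antisymm hIJ]
      · simp [a, h', hIJ]
    · push Not at h
      refine le_trans ?_ (hpack I (hC hI))
      rw [tsum_subtype, tsum_subtype F (fun J => a J I)]
      refine ENNReal.tsum_le_tsum fun J => indicator_le (fun J hJ => ?_) J
      by_cases h' : J ⊆ I
      · rw [indicator_of_mem (show J ∈ {J ∈ F | J ⊆ I} from ⟨hJ, h'⟩)]
        simp [a, h']
      · simp [a, h', h J hJ]
  calc ∑' J : F, netContent D φ (A ∩ J) ≤ ∑' J : F, ∑' I : C, a J I :=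
        ENNReal.tsum_le_tsum fun J => hle J J.2
    _ = ∑' I : C, ∑' J : F, a J I := ENNReal.tsum_comm
    _ ≤ ∑' I : C, 2 * φ I := ENNReal.tsum_le_tsum fun I => hge I I.2
    _ = 2 * ∑' I : C, φ I := ENNReal.tsum_mul_left

/-- Every subfamily of a net contains a packed subfamily whose total weight is comparable to the
content of the union. -/
theorem IsNet.exists_isPacked (hD : IsNet D) (hφ : ∀ I ∈ D, φ I ≠ ∞)
    (hmono : ∀ I J, I ⊆ J → φ I ≤ φ J) {Q : Set (Set X)} (hQ : Q ⊆ D) :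
    ∃ F ⊆ Q, IsPacked D φ F ∧ netContent D φ (⋃₀ Q) ≤ 2 * ∑' J : F, φ J := by
  have hchar : Order.IsOfFiniteCharacter {F | F ⊆ Q ∧ IsPacked D φ F} := by
    refine fun F => ⟨fun h G hG _ => ⟨hG.trans h.1, h.2.mono hG⟩, fun h => ⟨fun J hJ => ?_, ?_⟩⟩
    · exact (h {J} (by simpa using hJ) (finite_singleton J)).1 rfl
    · exact isPacked_of_finite_subsets fun G hG hfin => (h G hG hfin).2
  obtain ⟨F, -, hF⟩ := hchar.exists_maximal (x := ∅) ⟨empty_subset _, fun I _ => by simp⟩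
  obtain ⟨⟨hFQ, hpack⟩, hmax⟩ := hF
  refine ⟨F, hFQ, hpack, ?_⟩
  let sat : Set (Set X) := {I ∈ D | φ I ≤ ∑' J : {J ∈ F | J ⊆ I}, φ J}
  have hsat : sat ⊆ D := fun I hI => hI.1
  have hcover : ∀ J ∈ Q, J ∉ F → ∃ I ∈ sat, J ⊆ I := by
    intro J hJ hJF
    have hnot : ¬ IsPacked D φ (insert J F) := fun h =>
      hJF (hmax ⟨insert_subset hJ hFQ, h⟩ (subset_insert J F) (mem_insert J F))
    simp only [IsPacked, not_forall, not_le] at hnot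
    obtain ⟨I, hI, hlt⟩ := hnot
    have hJI : J ⊆ I := by
      by_contra hJI
      refine (hlt.trans_le ?_).not_ge (hpack I hI)
      refine ENNReal.tsum_mono_subtype φ fun L hL => ⟨hL.1.resolve_left ?_, hL.2⟩
      rintro rfl
      exact hJI hL.2
    refine ⟨I, ⟨hI, ?_⟩, hJI⟩
    have hsum : ∑' L : {L ∈ insert J F | L ⊆ I}, φ L ≤
        φ I + ∑' L : {L ∈ F | L ⊆ I}, φ L := by
      calc ∑' L : {L ∈ insert J F | L ⊆ I}, φ L
          ≤ ∑' L : ({J} ∪ {L ∈ F | L ⊆ I} : Set (Set X)), φ L := by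
            refine ENNReal.tsum_mono_subtype φ fun L hL => ?_
            rcases hL.1 with h | h
            · exact Or.inl h
            · exact Or.inr ⟨h, hL.2⟩
        _ ≤ φ J + ∑' L : {L ∈ F | L ⊆ I}, φ L := by
            simpa using ENNReal.tsum_union_le φ {J} {L ∈ F | L ⊆ I}
        _ ≤ _ := by gcongr; exact hmono J I hJI
    have hlt' := hlt.trans_le hsum
    rw [two_mul] at hlt'
    exact ((ENNReal.add_lt_add_iff_left (hφ I hI)).1 hlt').le
  have hsum : ∑' I : maximalMembers sat, φ I ≤ ∑' J : F, φ J := by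
    calc ∑' I : maximalMembers sat, φ I
        ≤ ∑' I : maximalMembers sat, ∑' J : {J ∈ F | J ⊆ (I : Set X)}, φ J :=
          ENNReal.tsum_le_tsum fun I => (maximalMembers_subset sat I.2).2
      _ = ∑' a : Σ I : maximalMembers sat, {J ∈ F | J ⊆ (I : Set X)}, φ a.2 :=
          (ENNReal.tsum_sigma' fun a : Σ I : maximalMembers sat,
            {J ∈ F | J ⊆ (I : Set X)} => φ a.2).symm
      _ ≤ ∑' J : F, φ J := by
          refine ENNReal.tsum_comp_le_tsum_of_injective
            (f := fun a : Σ I : maximalMembers sat, {J ∈ F | J ⊆ (I : Set X)} =>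
              (⟨a.2, a.2.2.1⟩ : F)) ?_ fun J : F => φ J
          rintro ⟨I, J, hJ⟩ ⟨I', J', hJ'⟩ h
          obtain rfl : J = J' := congrArg Subtype.val h
          obtain rfl : I = I' := by
            by_contra hne
            have hII' : Disjoint (I : Set X) I' := hD.disjoint_maximalMembers hsat I.2 I'.2
              fun h => hne (Subtype.ext h)
            exact (hD.nonempty J (hQ (hFQ hJ.1))).ne_empty
              (disjoint_self.1 (hII'.mono hJ.2 hJ'.2))
          rfl
  calc netContent D φ (⋃₀ Q) ≤ ∑' I : (F ∪ maximalMembers sat : Set (Set X)), φ I := by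
        refine netContent_le (union_subset (hFQ.trans hQ)
          ((maximalMembers_subset sat).trans hsat)) ?_
        rintro x ⟨J, hJ, hx⟩
        by_cases hJF : J ∈ F
        · exact ⟨J, Or.inl hJF, hx⟩
        · obtain ⟨I, hI, hJI⟩ := hcover J hJ hJF
          obtain ⟨L, hL, hIL⟩ := hD.exists_maximalMembers hsat hI
          exact ⟨L, Or.inr hL, hIL (hJI hx)⟩
    _ ≤ ∑' J : F, φ J + ∑' I : maximalMembers sat, φ I := ENNReal.tsum_union_le φ _ _
    _ ≤ 2 * ∑' J : F, φ J := by rw [two_mul]; gcongr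

theorem rpow_lintegral_le_lintegral_netContent [MeasurableSpace X] (hD : D.Countable)
    (μ : Measure X) {q : ℝ} (hq : 0 < q) (hq1 : q ≤ 1) {I : Set X} (hI : MeasurableSet I)
    {f : X → ℝ} (hf : AEMeasurable f (μ.restrict I)) :
    (∫⁻ x in I, ENNReal.ofReal |f x| ∂μ) ^ q ≤ ENNReal.ofReal (q⁻¹ ^ q) *
      ∫⁻ t in Ioi (0 : ℝ), netContent D (fun I => μ I ^ q) {x ∈ I | t < |f x| ^ q} := by
  set h : ℝ → ℝ≥0∞ := fun t => netContent D (fun I => μ I ^ q) {x ∈ I | t < |f x| ^ q} with hh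
  set A := ∫⁻ t in Ioi (0 : ℝ), h t with hA
  have hanti : Antitone h := fun a b hab => netContent_mono fun x hx => ⟨hx.1, hab.trans_lt hx.2⟩
  have hr : 0 ≤ q⁻¹ - 1 := sub_nonneg.2 ((one_le_inv₀ hq).2 hq1)
  have hcheb : ∀ t : ℝ, 0 < t → ENNReal.ofReal t * h t ≤ A := by
    intro t ht
    calc ENNReal.ofReal t * h t = ∫⁻ u in Ioc 0 t, h t := by simp [mul_comm]
      _ ≤ ∫⁻ u in Ioc 0 t, h u := setLIntegral_mono' measurableSet_Ioc fun u hu => hanti hu.2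
      _ ≤ A := lintegral_mono_set Ioc_subset_Ioi_self
  have hpoint : ∀ t ∈ Ioi (0 : ℝ), (μ.restrict I) {x | t < |f x| ^ q} *
      ENNReal.ofReal (t ^ (q⁻¹ - 1)) ≤ A ^ (q⁻¹ - 1) * h t := by
    intro t ht
    have ht : 0 < t := ht
    have hμ : (μ.restrict I) {x | t < |f x| ^ q} ≤ h t ^ q⁻¹ := by
      rw [ENNReal.le_rpow_inv_iff hq, Measure.restrict_apply' hI, inter_comm]
      exact measure_rpow_le_netContent hD μ hq hq1 _
    calc (μ.restrict I) {x | t < |f x| ^ q} * ENNReal.ofReal (t ^ (q⁻¹ - 1))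
        ≤ h t ^ (q⁻¹ - 1 + 1) * ENNReal.ofReal t ^ (q⁻¹ - 1) := by
          rw [sub_add_cancel, ← ENNReal.ofReal_rpow_of_pos ht]
          gcongr
      _ = (ENNReal.ofReal t * h t) ^ (q⁻¹ - 1) * h t := by
          rw [ENNReal.rpow_add_of_nonneg _ _ hr zero_le_one, ENNReal.rpow_one,
            ENNReal.mul_rpow_of_nonneg _ _ hr]
          ring
      _ ≤ _ := by
          gcongr
          exact hcheb t ht
  have hlayer : ∫⁻ x in I, ENNReal.ofReal |f x| ∂μ = ENNReal.ofReal q⁻¹ *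
      ∫⁻ t in Ioi (0 : ℝ), (μ.restrict I) {x | t < |f x| ^ q} *
        ENNReal.ofReal (t ^ (q⁻¹ - 1)) := by
    rw [← lintegral_rpow_eq_lintegral_meas_lt_mul (μ.restrict I)
      (Filter.Eventually.of_forall fun x => by positivity) (by fun_prop) (inv_pos.2 hq)]
    refine lintegral_congr fun x => ?_
    rw [Real.rpow_rpow_inv (abs_nonneg _) hq.ne']
  have hbound : ∫⁻ x in I, ENNReal.ofReal |f x| ∂μ ≤ ENNReal.ofReal q⁻¹ * A ^ q⁻¹ := by
    rw [hlayer]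
    gcongr
    calc _ ≤ ∫⁻ t in Ioi (0 : ℝ), A ^ (q⁻¹ - 1) * h t :=
          setLIntegral_mono' measurableSet_Ioi hpoint
      _ = A ^ (q⁻¹ - 1) * A := lintegral_const_mul _ hanti.measurable
      _ = A ^ (q⁻¹ - 1 + 1) := by
          rw [ENNReal.rpow_add_of_nonneg _ _ hr zero_le_one, ENNReal.rpow_one]
      _ = A ^ q⁻¹ := by rw [sub_add_cancel]
  calc (∫⁻ x in I, ENNReal.ofReal |f x| ∂μ) ^ q ≤ (ENNReal.ofReal q⁻¹ * A ^ q⁻¹) ^ q := by gcongr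
    _ = ENNReal.ofReal (q⁻¹ ^ q) * A := by
        rw [ENNReal.mul_rpow_of_nonneg _ _ hq.le, ENNReal.rpow_inv_rpow hq.ne',
          ENNReal.ofReal_rpow_of_pos (inv_pos.2 hq)]

/-- The weak type estimate for the maximal function of a net. -/
theorem IsNet.netContent_maximal_le [MeasurableSpace X] (hD : IsNet D)
    (hmeas : ∀ I ∈ D, MeasurableSet I) (μ : Measure X) [IsFiniteMeasure μ] {q : ℝ} (hq : 0 < q)
    (hq1 : q ≤ 1) {K : Set X} (hK : ∀ I ∈ D, I ⊆ K) {f : X → ℝ}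
    (hf : AEMeasurable f (μ.restrict K)) {t : ℝ} (ht : 0 < t) {E : Set X}
    (hE : ∀ x ∈ E, ∃ I ∈ D, x ∈ I ∧
      ENNReal.ofReal t < (∫⁻ y in I, ENNReal.ofReal |f y| ∂μ) / μ I) :
    netContent D (fun I => μ I ^ q) E ≤ ENNReal.ofReal (4 * q⁻¹ ^ q * t ^ (-q)) *
      ∫⁻ u in Ioi (0 : ℝ), netContent D (fun I => μ I ^ q) {x ∈ K | u < |f x| ^ q} := by
  set φ : Set X → ℝ≥0∞ := fun I => μ I ^ q with hφ
  let P : Set (Set X) :=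
    {I ∈ D | ENNReal.ofReal t < (∫⁻ y in I, ENNReal.ofReal |f y| ∂μ) / μ I}
  have hP : P ⊆ D := fun I hI => hI.1
  have hQ : maximalMembers P ⊆ D := (maximalMembers_subset P).trans hP
  obtain ⟨F, hFQ, hpack, hsel⟩ := hD.exists_isPacked (φ := φ)
    (fun I _ => ENNReal.rpow_ne_top_of_nonneg hq.le (measure_ne_top μ I))
    (fun I J h => ENNReal.rpow_le_rpow (measure_mono h) hq.le) hQ
  have hFD : F ⊆ D := hFQ.trans hQ
  have hdisj : F.PairwiseDisjoint id := (hD.disjoint_maximalMembers hP).subset hFQ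
  have hcover : E ⊆ ⋃₀ maximalMembers P := by
    intro x hx
    obtain ⟨I, hI, hxI, hlt⟩ := hE x hx
    obtain ⟨J, hJ, hIJ⟩ := hD.exists_maximalMembers hP (I := I) ⟨hI, hlt⟩
    exact ⟨J, hJ, hIJ hxI⟩
  let h : Set X → ℝ → ℝ≥0∞ := fun J u => netContent D φ ({x ∈ K | u < |f x| ^ q} ∩ J)
  have hanti : ∀ J, Antitone (h J) := fun J a b hab =>
    netContent_mono fun x hx => ⟨⟨hx.1.1, hab.trans_lt hx.1.2⟩, hx.2⟩
  have hcube : ∀ J ∈ F, φ J ≤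
      ENNReal.ofReal (t ^ (-q)) * ENNReal.ofReal (q⁻¹ ^ q) * ∫⁻ u in Ioi (0 : ℝ), h J u := by
    intro J hJ
    have hJD := hFD hJ
    have hlt := (maximalMembers_subset P (hFQ hJ)).2
    have hmul : ENNReal.ofReal t * μ J ≤ ∫⁻ y in J, ENNReal.ofReal |f y| ∂μ :=
      ENNReal.mul_le_of_le_div hlt.le
    have hint := rpow_lintegral_le_lintegral_netContent hD.countable μ hq hq1 (hmeas J hJD)
      (hf.mono_measure (Measure.restrict_mono (hK J hJD) le_rfl))
    have hsets : ∀ u : ℝ, {x ∈ J | u < |f x| ^ q} = {x ∈ K | u < |f x| ^ q} ∩ J := by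
      intro u
      ext x
      exact ⟨fun hx => ⟨⟨hK J hJD hx.1, hx.2⟩, hx.1⟩, fun hx => ⟨hx.2, hx.1.2⟩⟩
    simp only [hsets] at hint
    have ht0 : ENNReal.ofReal (t ^ (-q)) * ENNReal.ofReal t ^ q = 1 := by
      rw [ENNReal.ofReal_rpow_of_pos ht, ← ENNReal.ofReal_mul (by positivity),
        ← Real.rpow_add ht, neg_add_cancel, Real.rpow_zero, ENNReal.ofReal_one]
    calc φ J = ENNReal.ofReal (t ^ (-q)) * (ENNReal.ofReal t * μ J) ^ q := by
          rw [ENNReal.mul_rpow_of_nonneg _ _ hq.le, ← mul_assoc, ht0, one_mul]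
      _ ≤ ENNReal.ofReal (t ^ (-q)) * (ENNReal.ofReal (q⁻¹ ^ q) * ∫⁻ u in Ioi (0 : ℝ), h J u) := by
          gcongr
          exact (ENNReal.rpow_le_rpow hmul hq.le).trans hint
      _ = _ := (mul_assoc _ _ _).symm
  have : Countable F := (hD.countable.mono hFD).to_subtype
  have hsum : ∑' J : F, ∫⁻ u in Ioi (0 : ℝ), h J u ≤
      2 * ∫⁻ u in Ioi (0 : ℝ), netContent D φ {x ∈ K | u < |f x| ^ q} := by
    rw [← lintegral_tsum fun J : F => (hanti J).measurable.aemeasurable,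
      ← lintegral_const_mul' _ _ (by simp)]
    exact lintegral_mono fun u => hD.tsum_netContent_inter_le hFD hdisj hpack _
  calc netContent D φ E ≤ 2 * ∑' J : F, φ J := (netContent_mono hcover).trans hsel
    _ ≤ 2 * ∑' J : F, ENNReal.ofReal (t ^ (-q)) * ENNReal.ofReal (q⁻¹ ^ q) *
          ∫⁻ u in Ioi (0 : ℝ), h J u := by
        gcongr with J
        exact hcube J J.2
    _ ≤ 2 * (ENNReal.ofReal (t ^ (-q)) * ENNReal.ofReal (q⁻¹ ^ q) *
          (2 * ∫⁻ u in Ioi (0 : ℝ), netContent D φ {x ∈ K | u < |f x| ^ q})) := by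
        rw [ENNReal.tsum_mul_left]
        gcongr
    _ = _ := by
        rw [ENNReal.ofReal_mul (by positivity), ENNReal.ofReal_mul (by positivity),
          show ENNReal.ofReal 4 = 2 * 2 by norm_num]
        ring

end Net

namespace SimilitudeIFS

variable {d m : ℕ} {S : SimilitudeIFS d m} {K : Set (EuclideanSpace ℝ (Fin d))}

theorem map_injective (S : SimilitudeIFS d m) (i : Fin m) : Function.Injective (S.map i) := by
  intro x y h
  exact (S.rot i).injective
    (smul_right_injective _ (S.ratio_pos i).ne' (add_right_cancel h))

theorem continuous_map (S : SimilitudeIFS d m) (i : Fin m) : Continuous (S.map i) :=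
  ((S.rot i).continuous.const_smul (S.ratio i)).add (continuous_const (y := S.trans i))

theorem continuous_wordMap (S : SimilitudeIFS d m) : ∀ w, Continuous (S.wordMap w)
  | [] => continuous_id
  | i :: w => (S.continuous_map i).comp (S.continuous_wordMap w)

theorem cube_cons (S : SimilitudeIFS d m) (K : Set (EuclideanSpace ℝ (Fin d))) (i : Fin m)
    (w : List (Fin m)) : S.cube K (i :: w) = S.map i '' S.cube K w :=
  image_comp _ _ _

theorem IsSelfSimilarSet.cube_subset (hK : S.IsSelfSimilarSet K) : ∀ w, S.cube K w ⊆ K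
  | [] => by simp [cube, wordMap]
  | i :: w => by
    rw [cube_cons]
    refine (image_mono (hK.cube_subset w)).trans ?_
    conv_rhs => rw [hK.2.2]
    exact subset_iUnion (fun i => S.map i '' K) i

theorem IsSelfSimilarSet.cube_subset_or_disjoint (hK : S.IsSelfSimilarSet K)
    (hS : S.StrongSeparation K) : ∀ v w : List (Fin m),
      (v <+: w ∧ S.cube K w ⊆ S.cube K v) ∨ (w <+: v ∧ S.cube K v ⊆ S.cube K w) ∨
        Disjoint (S.cube K v) (S.cube K w)
  | [], w => Or.inl ⟨List.nil_prefix, by simpa [cube, wordMap] using hK.cube_subset w⟩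
  | v, [] => Or.inr <| Or.inl ⟨List.nil_prefix, by simpa [cube, wordMap] using hK.cube_subset v⟩
  | i :: v, j :: w => by
    rw [cube_cons, cube_cons]
    by_cases hij : i = j
    · subst hij
      rcases hK.cube_subset_or_disjoint hS v w with h | h | h
      · exact Or.inl ⟨(List.prefix_cons_inj i).2 h.1, image_mono h.2⟩
      · exact Or.inr <| Or.inl ⟨(List.prefix_cons_inj i).2 h.1, image_mono h.2⟩
      · exact Or.inr <| Or.inr <| (disjoint_image_iff (S.map_injective i)).2 h
    · exact Or.inr <| Or.inr <| (hS i j hij).mono (image_mono (hK.cube_subset v))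
        (image_mono (hK.cube_subset w))

theorem IsSelfSimilarSet.isNet (hK : S.IsSelfSimilarSet K) (hS : S.StrongSeparation K) :
    IsNet (S.basicCubes K) where
  countable := by
    refine (countable_range (S.cube K)).mono ?_
    rintro I ⟨w, rfl⟩
    exact mem_range_self w
  nonempty := by
    rintro I ⟨w, rfl⟩
    exact hK.1.image _
  nested := by
    rintro I ⟨v, rfl⟩ J ⟨w, rfl⟩
    rcases hK.cube_subset_or_disjoint hS v w with h | h | h
    · exact Or.inr (Or.inl h.2)
    · exact Or.inl h.2
    · exact Or.inr (Or.inr h)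
  finite_supersets := by
    rintro I ⟨w, rfl⟩
    have hfin : (S.cube K '' {v | v <+: w}).Finite := by
      refine Finite.image _ ((List.finite_toSet w.inits).subset fun v hv => ?_)
      exact (List.mem_inits v w).2 hv
    refine hfin.subset ?_
    rintro J ⟨⟨v, rfl⟩, hwv⟩
    rcases hK.cube_subset_or_disjoint hS v w with h | h | h
    · exact ⟨v, h.1, rfl⟩
    · exact ⟨w, List.prefix_rfl, hwv.antisymm h.2⟩
    · exact absurd (disjoint_self.1 (h.mono_left hwv)) (hK.1.image _).ne_empty

end SimilitudeIFS

theorem theorem1p2 {d m : ℕ} (S : SimilitudeIFS d m)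
    (K : Set (EuclideanSpace ℝ (Fin d))) (hK : S.IsSelfSimilarSet K)
    (hSSC : S.StrongSeparation K)
    (p : Fin m → ℝ) (hp_nonneg : ∀ i, 0 ≤ p i) (hp_sum : ∑ i, p i = 1)
    (μ : Measure (EuclideanSpace ℝ (Fin d))) (hμ : S.IsSelfSimilarMeasure p μ)
    (s : ℝ) (hs : dimH K = ENNReal.ofReal s)
    (α : ℝ) (hα_pos : 0 < α) (hα_le : α ≤ s)
    (f : EuclideanSpace ℝ (Fin d) → ℝ) (hf_meas : AEMeasurable f (μ.restrict K))
    (hf : S.choquetIntegral K μ s α (fun x => |f x| ^ (α / s)) < ∞)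
    (t : ℝ) (ht : 0 < t) :
    S.hausdorffContent K μ s α {x ∈ K | ENNReal.ofReal t < S.maximalFunction K μ f x} ≤
      ENNReal.ofReal (4 * (s / α) ^ (α / s) * t ^ (-(α / s))) *
        S.choquetIntegral K μ s α (fun x => |f x| ^ (α / s)) := by
  have hs_pos : 0 < s := hα_pos.trans_le hα_le
  have : IsProbabilityMeasure μ := hμ.1
  rw [← inv_div α s]
  refine (hK.isNet hSSC).netContent_maximal_le ?_ μ (div_pos hα_pos hs_pos)
    ((div_le_one hs_pos).2 hα_le) ?_ hf_meas ht ?_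
  · rintro I ⟨w, rfl⟩
    exact (hK.2.1.image (S.continuous_wordMap w)).measurableSet
  · rintro I ⟨w, rfl⟩
    exact hK.cube_subset w
  · rintro x ⟨-, hx⟩
    simp only [SimilitudeIFS.maximalFunction, lt_iSup_iff] at hx
    obtain ⟨w, hxw, hlt⟩ := hx
    exact ⟨_, ⟨w, rfl⟩, hxw, hlt⟩
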